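/- For a function $f:[0,1]\to\mathbb{R}$ and an integer $n\ge 1$, let $$L_n(f)=\frac1n\sum_{k=0}^{n-1} f\!\left(\tfrac kn\right),\qquad R_n(f)=\frac1n\sum_{k=1}^{n} f\!\left(\tfrac kn\right)$$ be the left and right Riemann sums of $f$ over the uniform partition of $[0,1]$ into $n$ intervals. Let $f_b(x)=\frac{1}{1-bx+x^2}$ for real $b<2$, and let $\beta^+=\frac{3+\sqrt{13}}{4}\approx 1.651388$. Here a sequence $(a_n)_{n\ge1}$ is called increasing if $a_n\le a_{n+1}$ for all $n\ge 1$, and decreasing if $a_n\ge a_{n+1}$ for all $n\ge1$. Then: 1. $(L_n(f_b))_{n\ge1}$ is decreasing for every $b\in(-\infty,\frac12]$ and increasing for every $b\in[1,\beta^+]$. 2. $(R_n(f_b))_{n\ge1}$ is increasing for every $b\in(-\infty,1]$ and decreasing for every $b\in[\frac32,\beta^+]$. -/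

import Mathlib

/-- The left Riemann sum `L_n(f) = (1/n) ∑_{k=0}^{n-1} f(k/n)` of `f` with respect to the uniform
partition of `[0,1]` into `n` intervals. It is meaningful for `n ≥ 1`. -/
noncomputable def leftRiemannSum (f : ℝ → ℝ) (n : ℕ) : ℝ :=
  (1 / (n : ℝ)) * ∑ k ∈ Finset.range n, f ((k : ℝ) / (n : ℝ))

/-- The right Riemann sum `R_n(f) = (1/n) ∑_{k=1}^{n} f(k/n)` of `f` with respect to the uniform
partition of `[0,1]` into `n` intervals. It is meaningful for `n ≥ 1`. -/
noncomputable def rightRiemannSum (f : ℝ → ℝ) (n : ℕ) : ℝ :=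
  (1 / (n : ℝ)) * ∑ k ∈ Finset.Icc 1 n, f ((k : ℝ) / (n : ℝ))

/-- The function `f_b(x) = 1 / (1 - b x + x²)`. For `b < 2` its denominator is positive
on `[0,1]`. -/
noncomputable def fb (b x : ℝ) : ℝ := 1 / (1 - b * x + x ^ 2)

/-- The constant `β⁺ = (3 + √13) / 4`. -/
noncomputable def betaPlus : ℝ := (3 + Real.sqrt 13) / 4

/-! For `b ≤ -1`, `fb b` is convex on `[0,1]` with minimum at 1, and interpolation between
neighbouring grids gives both claims. Otherwise Euler–Maclaurin gives `L_n = I + p/n + q/n² +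
O(K/n⁴)` with `p = (f 0 - f 1)/2`, `q = -(f' 0 - f' 1)/12`, `K = sup |f⁗| / 720`; for `R_n` the sign
of `p` flips. The constants are explicit enough for `p/n` to decide the comparison for all `n ≥ 2`
(`step_of_expansion`), while `n = 1` is settled by exact values. The endpoints `1` are where `p`
changes sign; `1/2` and `3/2` are where the first two sums agree. -/

/-! ### Corrected trapezoidal rule on one cell -/

/-- Integrating a polynomial bound on a derivative. -/
lemma abs_le_of_abs_deriv_le {g g' : ℝ → ℝ} {C : ℝ} (m : ℕ) (h0 : g 0 = 0)
    (hg : ∀ t, HasDerivAt g (g' t) t) (hb : ∀ t, 0 ≤ t → |g' t| ≤ C * t ^ m) {t : ℝ} (ht : 0 ≤ t) :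
    |g t| ≤ C / (m + 1) * t ^ (m + 1) := by
  have key := image_norm_le_of_norm_deriv_right_le_deriv_boundary (f := g) (f' := g') (a := 0)
    (b := t) (B := fun s => C / (m + 1) * s ^ (m + 1)) (B' := fun s => C * s ^ m)
    (fun s _ => (hg s).continuousAt.continuousWithinAt) (fun s _ => (hg s).hasDerivWithinAt)
    (by simp [h0])
    (fun s => by
      have := (hasDerivAt_pow (m + 1) s).const_mul (C / (m + 1))
      refine this.congr_deriv ?_
      have : (m : ℝ) + 1 ≠ 0 := by positivity
      push_cast
      field_simp)
    (fun s hs => hb s hs.1)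
  exact key ⟨ht, le_rfl⟩

/-- The error of the trapezoidal rule with endpoint correction on a single interval. -/
lemma corrected_trapezoid_cell {F f f₁ f₂ f₃ f₄ : ℝ → ℝ} {M : ℝ}
    (hF : ∀ x, HasDerivAt F (f x) x) (h₀ : ∀ x, HasDerivAt f (f₁ x) x)
    (h₁ : ∀ x, HasDerivAt f₁ (f₂ x) x) (h₂ : ∀ x, HasDerivAt f₂ (f₃ x) x)
    (h₃ : ∀ x, HasDerivAt f₃ (f₄ x) x) (hM : ∀ x, |f₄ x| ≤ M) (a : ℝ) {t : ℝ} (ht : 0 ≤ t) :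
    |t / 2 * (f a + f (a + t)) - (F (a + t) - F a) - t ^ 2 / 12 * (f₁ (a + t) - f₁ a)|
      ≤ M / 720 * t ^ 5 := by
  have shift : ∀ {g g' : ℝ → ℝ}, (∀ x, HasDerivAt g (g' x) x) →
      ∀ s, HasDerivAt (fun s => g (a + s)) (g' (a + s)) s := fun h s => by
    simpa using (h (a + s)).comp_const_add a s
  -- The error and its first two derivatives vanish at `0`, and the third is `-s²/12 · f₄`; three
  -- integrations turn `M/12` into `M/720`.
  have d3 : ∀ s, HasDerivAt
      (fun s => s / 6 * f₂ (a + s) - 1 / 6 * (f₁ (a + s) - f₁ a) - s ^ 2 / 12 * f₃ (a + s))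
      (-(s ^ 2 / 12 * f₄ (a + s))) s := fun s => by
    refine (((((hasDerivAt_id s).div_const 6).mul (shift h₂ s)).sub
      (((shift h₁ s).sub_const (f₁ a)).const_mul (1 / 6))).sub
      ((((hasDerivAt_id s).pow 2).div_const 12).mul (shift h₃ s))).congr_deriv ?_
    simp; ring
  have d2 : ∀ s, HasDerivAt
      (fun s => 1 / 2 * (f a + f (a + s)) + s / 2 * f₁ (a + s) - f (a + s)
        - s / 6 * (f₁ (a + s) - f₁ a) - s ^ 2 / 12 * f₂ (a + s))
      (s / 6 * f₂ (a + s) - 1 / 6 * (f₁ (a + s) - f₁ a) - s ^ 2 / 12 * f₃ (a + s)) s := fun s => by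
    refine (((((((shift h₀ s).const_add (f a)).const_mul (1 / 2)).add
      (((hasDerivAt_id s).div_const 2).mul (shift h₁ s))).sub (shift h₀ s)).sub
      (((hasDerivAt_id s).div_const 6).mul ((shift h₁ s).sub_const (f₁ a)))).sub
      ((((hasDerivAt_id s).pow 2).div_const 12).mul (shift h₂ s))).congr_deriv ?_
    simp; ring
  have d1 : ∀ s, HasDerivAt
      (fun s => s / 2 * (f a + f (a + s)) - (F (a + s) - F a)
        - s ^ 2 / 12 * (f₁ (a + s) - f₁ a))
      (1 / 2 * (f a + f (a + s)) + s / 2 * f₁ (a + s) - f (a + s)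
        - s / 6 * (f₁ (a + s) - f₁ a) - s ^ 2 / 12 * f₂ (a + s)) s := fun s => by
    refine (((((hasDerivAt_id s).div_const 2).mul ((shift h₀ s).const_add (f a))).sub
      ((shift hF s).sub_const (F a))).sub
      ((((hasDerivAt_id s).pow 2).div_const 12).mul ((shift h₁ s).sub_const (f₁ a)))).congr_deriv ?_
    simp; ring
  have b3 : ∀ s : ℝ, 0 ≤ s → |-(s ^ 2 / 12 * f₄ (a + s))| ≤ M / 12 * s ^ 2 := fun s _ => by
    rw [abs_neg, abs_mul, abs_of_nonneg (by positivity)]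
    nlinarith [mul_le_mul_of_nonneg_left (hM (a + s)) (sq_nonneg s)]
  have b2 := fun s (hs : (0 : ℝ) ≤ s) => abs_le_of_abs_deriv_le 2 (by simp) d3 b3 hs
  have b1 := fun s (hs : (0 : ℝ) ≤ s) => abs_le_of_abs_deriv_le 3 (by norm_num; ring) d2 b2 hs
  have b0 := abs_le_of_abs_deriv_le 4 (by simp) d1 b1 ht
  refine b0.trans (le_of_eq ?_)
  push_cast
  ring

/-! ### Left versus right sums; the convex case -/

lemma rightRiemannSum_eq (f : ℝ → ℝ) {n : ℕ} (hn : 1 ≤ n) :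
    rightRiemannSum f n = leftRiemannSum f n + (f 1 - f 0) / n := by
  have hn' : (n : ℝ) ≠ 0 := by positivity
  have h : ∑ k ∈ Finset.Icc 1 n, f ((k : ℝ) / n) = ∑ k ∈ Finset.range n, f ((k + 1 : ℕ) / (n : ℝ)) := by
    rw [Finset.range_eq_Ico, Finset.sum_Ico_add' (fun k : ℕ => f ((k : ℝ) / n)) 0 n 1]
    rfl
  have h2 := Finset.sum_range_sub (fun k : ℕ => f ((k : ℝ) / n)) n
  rw [Finset.sum_sub_distrib, div_self hn'] at h2
  simp only [Nat.cast_zero, zero_div] at h2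
  rw [rightRiemannSum, leftRiemannSum, h, ← h2]
  ring

/-- Convexity on `[0, 1]` compares the values at two consecutive points of one grid with the value
at an intermediate point. -/
lemma leftRiemannSum_succ_le_of_convexOn {f : ℝ → ℝ} (hc : ConvexOn ℝ (Set.Icc 0 1) f)
    (hf : ∀ x ∈ Set.Icc (0 : ℝ) 1, f 1 ≤ f x) {n : ℕ} (hn : 1 ≤ n) :
    leftRiemannSum f (n + 1) ≤ leftRiemannSum f n := by
  have hn0 : (0 : ℝ) < n := by positivity
  have hpt : ∀ k ∈ Finset.range n, f ((k + 1 : ℕ) / ((n + 1 : ℕ) : ℝ)) ≤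
      (k + 1) / (n + 1) * f (k / n) + (n - k) / (n + 1) * f ((k + 1 : ℕ) / n) := by
    intro k hk
    have hk' : (k : ℝ) + 1 ≤ n := by exact_mod_cast Finset.mem_range.1 hk
    have hx : (k : ℝ) / n ∈ Set.Icc (0 : ℝ) 1 :=
      ⟨by positivity, by rw [div_le_one hn0]; linarith⟩
    have hy : (k + 1 : ℕ) / (n : ℝ) ∈ Set.Icc (0 : ℝ) 1 :=
      ⟨by positivity, by rw [div_le_one hn0]; push_cast; linarith⟩
    have ha : (0 : ℝ) ≤ (k + 1) / (n + 1) := by positivity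
    have hb : (0 : ℝ) ≤ (n - k) / (n + 1) := div_nonneg (by linarith) (by positivity)
    have := hc.2 hx hy ha hb (by field_simp; ring)
    simp only [smul_eq_mul] at this
    refine (congrArg f ?_).trans_le this
    push_cast
    field_simp
    ring
  have hS := Finset.sum_le_sum hpt
  have hmin : n * f 1 ≤ ∑ k ∈ Finset.range n, f ((k : ℝ) / n) := by
    have := Finset.card_nsmul_le_sum (Finset.range n) (fun k : ℕ => f ((k : ℝ) / n)) (f 1)
      (fun k hk => hf _ ⟨by positivity, by
        rw [div_le_one hn0]; exact_mod_cast (Finset.mem_range.1 hk).le⟩)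
    simpa using this
  -- The weights vary with `k`; Abel summation makes them constant up to a telescoping term.
  have htel := Finset.sum_range_sub (fun k : ℕ => (n - k + 1 : ℝ) * f ((k : ℝ) / n)) n
  have hsplit : ∑ k ∈ Finset.range n,
      ((k + 1 : ℝ) / (n + 1) * f (k / n) + (n - k) / (n + 1) * f ((k + 1 : ℕ) / n)) =
      (n + 2) / (n + 1) * ∑ k ∈ Finset.range n, f ((k : ℝ) / n)
        + 1 / (n + 1) * f 1 - f 0 := by
    have : ∀ k ∈ Finset.range n,
        ((k + 1 : ℝ) / (n + 1) * f (k / n) + (n - k) / (n + 1) * f ((k + 1 : ℕ) / n)) =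
        (n + 2) / (n + 1) * f ((k : ℝ) / n) + 1 / (n + 1) *
          ((n - (k + 1 : ℕ) + 1 : ℝ) * f ((k + 1 : ℕ) / n) - (n - k + 1) * f (k / n)) := by
      intro k _
      push_cast
      field_simp
      ring
    rw [Finset.sum_congr rfl this, Finset.sum_add_distrib, ← Finset.mul_sum, ← Finset.mul_sum, htel,
      div_self hn0.ne']
    simp only [Nat.cast_zero, zero_div]
    field_simp
    ring
  rw [hsplit] at hS
  rw [leftRiemannSum, leftRiemannSum, Finset.sum_range_succ' (fun k : ℕ => f (k / ((n + 1 : ℕ) : ℝ)))]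
  set A := ∑ k ∈ Finset.range n, f ((k + 1 : ℕ) / ((n + 1 : ℕ) : ℝ))
  set B := ∑ k ∈ Finset.range n, f ((k : ℝ) / n)
  simp only [Nat.cast_zero, zero_div]
  push_cast
  rw [one_div, one_div, inv_mul_le_iff₀ (by positivity)]
  have h1 : 1 / ((n : ℝ) + 1) * f 1 ≤ 1 / (n + 1) * (B / n) := by
    gcongr
    rw [le_div_iff₀ hn0]; linarith
  have h2 : ((n : ℝ) + 1) * ((n : ℝ)⁻¹ * B) = (n + 2) / (n + 1) * B + 1 / (n + 1) * (B / n) := by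
    field_simp; ring
  linarith

/-- Here `k/n` is interpolated between `k/(n+1)` and `(k+1)/(n+1)`; the excess is `(R' - f 1)/n ≥
0`. -/
lemma rightRiemannSum_le_succ_of_convexOn {f : ℝ → ℝ} (hc : ConvexOn ℝ (Set.Icc 0 1) f)
    (hf : ∀ x ∈ Set.Icc (0 : ℝ) 1, f 1 ≤ f x) {n : ℕ} (hn : 1 ≤ n) :
    rightRiemannSum f n ≤ rightRiemannSum f (n + 1) := by
  have hn0 : (0 : ℝ) < n := by positivity
  have hpt : ∀ k ∈ Finset.range (n + 1), f ((k : ℝ) / n) ≤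
      (n - k) / n * f (k / (n + 1 : ℕ)) + k / n * f ((k + 1 : ℕ) / ((n + 1 : ℕ) : ℝ)) := by
    intro k hk
    have hk' : (k : ℝ) ≤ n := by exact_mod_cast Nat.lt_succ_iff.1 (Finset.mem_range.1 hk)
    have hx : (k : ℝ) / (n + 1 : ℕ) ∈ Set.Icc (0 : ℝ) 1 :=
      ⟨by positivity, by rw [div_le_one (by positivity)]; push_cast; linarith⟩
    have hy : (k + 1 : ℕ) / ((n + 1 : ℕ) : ℝ) ∈ Set.Icc (0 : ℝ) 1 :=
      ⟨by positivity, by rw [div_le_one (by positivity)]; push_cast; linarith⟩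
    have ha : (0 : ℝ) ≤ (n - k) / n := div_nonneg (by linarith) (by positivity)
    have hb : (0 : ℝ) ≤ k / n := by positivity
    have := hc.2 hx hy ha hb (by field_simp; ring)
    simp only [smul_eq_mul] at this
    refine (congrArg f ?_).trans_le this
    push_cast
    field_simp
    ring
  have hS := Finset.sum_le_sum hpt
  have hmin : (n + 1) * f 1 ≤ (n + 1) * rightRiemannSum f (n + 1) := by
    have := Finset.card_nsmul_le_sum (Finset.Icc 1 (n + 1))
      (fun k : ℕ => f ((k : ℝ) / (n + 1 : ℕ))) (f 1)
      (fun k hk => hf _ ⟨by positivity, by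
        rw [div_le_one (by positivity)]; exact_mod_cast (Finset.mem_Icc.1 hk).2⟩)
    rw [rightRiemannSum]
    simp only [Nat.card_Icc, nsmul_eq_mul, add_tsub_cancel_right] at this
    push_cast at this ⊢
    rwa [← mul_assoc, mul_one_div_cancel (by positivity), one_mul]
  have htel := Finset.sum_range_sub
    (fun k : ℕ => (k - 1 : ℝ) * f ((k : ℝ) / (n + 1 : ℕ))) (n + 1)
  have hsplit : ∑ k ∈ Finset.range (n + 1),
      ((n - k) / n * f (k / (n + 1 : ℕ)) + k / n * f ((k + 1 : ℕ) / ((n + 1 : ℕ) : ℝ))) =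
      (n - 1) / n * ∑ k ∈ Finset.range (n + 1), f ((k : ℝ) / (n + 1 : ℕ))
        + f 1 + 1 / n * f 0 := by
    have : ∀ k ∈ Finset.range (n + 1),
        ((n - k) / n * f (k / (n + 1 : ℕ)) + k / n * f ((k + 1 : ℕ) / ((n + 1 : ℕ) : ℝ))) =
        (n - 1) / n * f ((k : ℝ) / (n + 1 : ℕ)) + 1 / n *
          (((k + 1 : ℕ) - 1 : ℝ) * f ((k + 1 : ℕ) / ((n + 1 : ℕ) : ℝ))
            - (k - 1) * f (k / (n + 1 : ℕ))) := by
      intro k _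
      push_cast
      field_simp
      ring
    rw [Finset.sum_congr rfl this, Finset.sum_add_distrib, ← Finset.mul_sum, ← Finset.mul_sum, htel,
      div_self (by positivity)]
    simp only [Nat.cast_zero, zero_div]
    push_cast
    field_simp
    ring
  rw [hsplit, Finset.sum_range_succ, div_self hn0.ne'] at hS
  have e1 := rightRiemannSum_eq f hn
  have e2 := rightRiemannSum_eq f (Nat.le_add_left 1 n)
  rw [leftRiemannSum] at e1 e2
  set A := ∑ k ∈ Finset.range (n + 1), f ((k : ℝ) / (n + 1 : ℕ))
  set B := ∑ k ∈ Finset.range n, f ((k : ℝ) / n)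
  push_cast at e1 e2
  set R := rightRiemannSum f n
  set R' := rightRiemannSum f (n + 1)
  have hB : B = n * R - f 1 + f 0 := by rw [e1]; field_simp; ring
  have hA : A = (n + 1) * R' - f 1 + f 0 := by rw [e2]; field_simp; ring
  rw [hA, hB] at hS
  have h3 : f 1 ≤ R' := le_of_mul_le_mul_left hmin (by positivity)
  have h4 : ((n : ℝ) - 1) / n * ((n + 1) * R' - f 1 + f 0) + f 1 + 1 / n * f 0 =
      n * R' + f 0 - (R' - f 1) / n := by field_simp; ring
  have h5 : 0 ≤ (R' - f 1) / n := div_nonneg (by linarith) hn0.le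
  rw [h4] at hS
  exact le_of_mul_le_mul_left (by linarith : (n : ℝ) * R ≤ n * R') hn0

/-! ### Expansion of the sums and comparison of consecutive terms -/

lemma corrected_trapezoid_sum {F f f₁ f₂ f₃ f₄ : ℝ → ℝ} {M : ℝ}
    (hF : ∀ x, HasDerivAt F (f x) x) (h₀ : ∀ x, HasDerivAt f (f₁ x) x)
    (h₁ : ∀ x, HasDerivAt f₁ (f₂ x) x) (h₂ : ∀ x, HasDerivAt f₂ (f₃ x) x)
    (h₃ : ∀ x, HasDerivAt f₃ (f₄ x) x) (hM : ∀ x, |f₄ x| ≤ M) {n : ℕ} (hn : 1 ≤ n) :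
    |leftRiemannSum f n - ((F 1 - F 0) + (f 0 - f 1) / 2 / n - (f₁ 0 - f₁ 1) / 12 / n ^ 2)|
      ≤ M / 720 / n ^ 4 := by
  have hn0 : (0 : ℝ) < n := by positivity
  have hcell : ∀ k ∈ Finset.range n,
      -- Trapezoid written as left value plus half an increment, so that all but the left sum
      -- telescopes.
      |1 / (n : ℝ) * f (k / n) + (1 / n / 2 * (f ((k + 1 : ℕ) / n) - f (k / n))
        - (F ((k + 1 : ℕ) / n) - F (k / n))
        - (1 / n) ^ 2 / 12 * (f₁ ((k + 1 : ℕ) / n) - f₁ (k / n)))| ≤ M / 720 * (1 / n) ^ 5 := by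
    intro k _
    have h := corrected_trapezoid_cell hF h₀ h₁ h₂ h₃ hM (k / n : ℝ) (t := 1 / n) (by positivity)
    rw [show (k : ℝ) / n + 1 / n = (k + 1 : ℕ) / n by push_cast; ring] at h
    convert h using 2
    ring
  have hsum := (Finset.abs_sum_le_sum_abs _ _).trans (Finset.sum_le_sum hcell)
  have tel := fun g : ℝ → ℝ => Finset.sum_range_sub (fun k : ℕ => g ((k : ℝ) / n)) n
  rw [Finset.sum_add_distrib, Finset.sum_sub_distrib, Finset.sum_sub_distrib, ← Finset.mul_sum,
    ← Finset.mul_sum, ← Finset.mul_sum, tel f, tel F, tel f₁, div_self hn0.ne'] at hsum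
  simp only [Nat.cast_zero, zero_div, Finset.sum_const, Finset.card_range, nsmul_eq_mul] at hsum
  rw [leftRiemannSum]
  refine le_of_eq_of_le (congrArg abs ?_) (hsum.trans_eq ?_)
  · field_simp
    ring
  · field_simp

/-- After clearing denominators the main term `p x(x+1) + q(2x+1)` equals `p y² + (5p+2q) y +
(6p+5q)` with `y = x - 2`, whence the hypotheses. The factor of `K` decreases in `x`, from `(3/2)² +
(2/3)² = 97/36` at `x = 2`. -/
lemma step_of_expansion {p q K I : ℝ} {A : ℕ → ℝ} (hp : 0 ≤ p) (hpq : 0 ≤ 5 * p + 2 * q)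
    (hK : 97 / 36 * K ≤ 6 * p + 5 * q)
    (hA : ∀ n : ℕ, 1 ≤ n → |A n - (I + p / n + q / n ^ 2)| ≤ K / n ^ 4) {n : ℕ} (hn : 2 ≤ n) :
    A (n + 1) ≤ A n := by
  have h1 := abs_le.1 (hA n (by omega))
  have h2 := abs_le.1 (hA (n + 1) (by omega))
  have hK0 : 0 ≤ K := by simpa using (abs_nonneg _).trans (hA 1 le_rfl)
  have hx : (2 : ℝ) ≤ n := by exact_mod_cast hn
  push_cast at h2
  set x : ℝ := (n : ℝ)
  have hx0 : 0 < x := by linarith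
  have e : p / x + q / x ^ 2 - p / (x + 1) - q / (x + 1) ^ 2 - K / x ^ 4 - K / (x + 1) ^ 4 =
      (p * (x * (x + 1)) + q * (2 * x + 1) - K * ((x + 1) ^ 2 / x ^ 2 + x ^ 2 / (x + 1) ^ 2))
        / (x ^ 2 * (x + 1) ^ 2) := by
    field_simp
    ring
  have h3 : (x + 1) ^ 2 / x ^ 2 + x ^ 2 / (x + 1) ^ 2 ≤ 97 / 36 := by
    rw [div_add_div _ _ (by positivity) (by positivity), div_le_div_iff₀ (by positivity) (by positivity)]
    have : (x - 2) * (x + 3) ≥ 0 := mul_nonneg (by linarith) (by linarith)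
    nlinarith
  have h4 : 0 ≤ p / x + q / x ^ 2 - p / (x + 1) - q / (x + 1) ^ 2 - K / x ^ 4 - K / (x + 1) ^ 4 := by
    rw [e]
    refine div_nonneg ?_ (by positivity)
    nlinarith [mul_le_mul_of_nonneg_left h3 hK0, mul_nonneg hp (sq_nonneg (x - 2)),
      mul_nonneg hpq (sub_nonneg.2 hx)]
  linarith [h1.1, h2.2]

/-! ### Derivatives of `fb` -/

lemma quadratic_pos {b : ℝ} (hb : 0 < 1 - b ^ 2 / 4) (x : ℝ) : 0 < 1 - b * x + x ^ 2 := by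
  nlinarith [sq_nonneg (x - b / 2)]

lemma hasDerivAt_primitive_fb {b : ℝ} (hb : 0 < 1 - b ^ 2 / 4) (x : ℝ) :
    HasDerivAt (fun x => Real.arctan ((x - b / 2) / √(1 - b ^ 2 / 4)) / √(1 - b ^ 2 / 4))
      (fb b x) x := by
  have hs := Real.sqrt_pos.2 hb
  have h2 := Real.sq_sqrt hb.le
  refine ((((hasDerivAt_id x).sub_const (b / 2)).div_const _).arctan.div_const _).congr_deriv ?_
  have hq := quadratic_pos hb x
  have h3 : (1 - b * x + x ^ 2) = √(1 - b ^ 2 / 4) ^ 2 + (x - b / 2) ^ 2 := by rw [h2]; ring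
  rw [fb, h3]
  simp only [id]
  generalize √(1 - b ^ 2 / 4) = s at hs
  have h4 : 1 + ((x - b / 2) / s) ^ 2 = (s ^ 2 + (x - b / 2) ^ 2) / s ^ 2 := by field_simp
  rw [h4]
  have h5 : s ^ 2 + (x - b / 2) ^ 2 ≠ 0 := by positivity
  generalize s ^ 2 + (x - b / 2) ^ 2 = r at h5
  field_simp

lemma hasDerivAt_quadratic_pow (b : ℝ) (m : ℕ) (x : ℝ) :
    HasDerivAt (fun x => (1 - b * x + x ^ 2) ^ m)
      (m * (1 - b * x + x ^ 2) ^ (m - 1) * (2 * x - b)) x := by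
  have : HasDerivAt (fun x => 1 - b * x + x ^ 2) (2 * x - b) x := by
    refine ((((hasDerivAt_id x).const_mul b).const_sub 1).add (hasDerivAt_pow 2 x)).congr_deriv ?_
    simp; ring
  exact this.pow m

lemma hasDerivAt_fb {b : ℝ} (hb : 0 < 1 - b ^ 2 / 4) (x : ℝ) : HasDerivAt (fb b) ((b - 2 * x) / (1 - b * x + x ^ 2) ^ 2) x := by
  have hq := (quadratic_pos hb x).ne'
  have := (hasDerivAt_const x (1 : ℝ)).div (hasDerivAt_quadratic_pow b 1 x) (by simpa using hq)
  simp only [pow_one] at this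
  refine this.congr_deriv ?_
  simp

lemma hasDerivAt_deriv_fb {b : ℝ} (hb : 0 < 1 - b ^ 2 / 4) (x : ℝ) :
    HasDerivAt (fun x => (b - 2 * x) / (1 - b * x + x ^ 2) ^ 2)
      (2 * (3 * x ^ 2 - 3 * b * x + b ^ 2 - 1) / (1 - b * x + x ^ 2) ^ 3) x := by
  have hq := quadratic_pos hb x
  refine ((((hasDerivAt_id x).const_mul 2).const_sub b).div (hasDerivAt_quadratic_pow b 2 x)
    (by positivity)).congr_deriv ?_
  simp only [id]
  rw [div_eq_div_iff (by positivity) (by positivity)]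
  push_cast
  ring

lemma hasDerivAt_deriv2_fb {b : ℝ} (hb : 0 < 1 - b ^ 2 / 4) (x : ℝ) :
    HasDerivAt (fun x => 2 * (3 * x ^ 2 - 3 * b * x + b ^ 2 - 1) / (1 - b * x + x ^ 2) ^ 3)
      (24 * (x - b / 2) * (1 - b ^ 2 / 4 - (x - b / 2) ^ 2) / (1 - b * x + x ^ 2) ^ 4) x := by
  have hq := quadratic_pos hb x
  refine (((((((hasDerivAt_pow 2 x).const_mul 3).sub ((hasDerivAt_id x).const_mul (3 * b))).add_const
    (b ^ 2)).sub_const 1).const_mul 2).div (hasDerivAt_quadratic_pow b 3 x)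
    (by positivity)).congr_deriv ?_
  simp only [id, Pi.sub_apply]
  rw [div_eq_div_iff (by positivity) (by positivity)]
  push_cast
  ring

lemma hasDerivAt_deriv3_fb {b : ℝ} (hb : 0 < 1 - b ^ 2 / 4) (x : ℝ) :
    HasDerivAt
      (fun x => 24 * (x - b / 2) * (1 - b ^ 2 / 4 - (x - b / 2) ^ 2) / (1 - b * x + x ^ 2) ^ 4)
      (24 * (5 * (x - b / 2) ^ 4 - 10 * (1 - b ^ 2 / 4) * (x - b / 2) ^ 2 + (1 - b ^ 2 / 4) ^ 2)
        / (1 - b * x + x ^ 2) ^ 5) x := by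
  have hq := quadratic_pos hb x
  refine (((((hasDerivAt_id x).sub_const (b / 2)).const_mul 24).mul
    ((((hasDerivAt_id x).sub_const (b / 2)).pow 2).const_sub (1 - b ^ 2 / 4))).div
    (hasDerivAt_quadratic_pow b 4 x) (by positivity)).congr_deriv ?_
  simp only [id, Pi.pow_apply]
  rw [div_eq_div_iff (by positivity) (by positivity)]
  simp
  ring

lemma abs_deriv4_fb_le {b : ℝ} (hb : 0 < 1 - b ^ 2 / 4) (x : ℝ) :
    |24 * (5 * (x - b / 2) ^ 4 - 10 * (1 - b ^ 2 / 4) * (x - b / 2) ^ 2 + (1 - b ^ 2 / 4) ^ 2)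
        / (1 - b * x + x ^ 2) ^ 5| ≤ 24 / (1 - b ^ 2 / 4) ^ 3 := by
  have hq := quadratic_pos hb x
  have hx : 1 - b * x + x ^ 2 = (1 - b ^ 2 / 4) + (x - b / 2) ^ 2 := by ring
  rw [abs_div, abs_of_pos (pow_pos hq 5), div_le_div_iff₀ (by positivity) (by positivity), hx]
  have ht := sq_nonneg (x - b / 2)
  rw [show (x - b / 2) ^ 4 = ((x - b / 2) ^ 2) ^ 2 by ring]
  generalize 1 - b ^ 2 / 4 = S at *
  generalize (x - b / 2) ^ 2 = t at *
  have key : (S + t) ^ 5 = S ^ 5 + 5 * S ^ 4 * t + 10 * S ^ 3 * t ^ 2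
    + (10 * S ^ 2 * t ^ 3 + 5 * S * t ^ 4 + t ^ 5) := by ring
  have k1 : 0 ≤ 10 * S ^ 2 * t ^ 3 + 5 * S * t ^ 4 + t ^ 5 := by positivity
  have k2 : 0 ≤ S ^ 4 * t := by positivity
  have k3 : 0 ≤ S ^ 3 * t ^ 2 := by positivity
  -- Twice this square absorbs the term `-5 S⁴ t` in the lower bound.
  have k4 : 0 ≤ S ^ 3 * (S - 5 / 4 * t) ^ 2 := by positivity
  rw [abs_mul, abs_of_pos (by norm_num : (0 : ℝ) < 24), mul_assoc]
  refine mul_le_mul_of_nonneg_left ?_ (by norm_num)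
  rw [← abs_of_pos (pow_pos hb 3), ← abs_mul, abs_le]
  constructor <;> nlinarith


/-! ### Expansions and first values for `fb` -/

lemma leftRiemannSum_fb_expansion {b : ℝ} (hb : 0 < 1 - b ^ 2 / 4) :
    ∃ I : ℝ, ∀ n : ℕ, 1 ≤ n → |leftRiemannSum (fb b) n
      - (I + (1 - 1 / (2 - b)) / 2 / n + -(b + 1 / (2 - b)) / 12 / n ^ 2)|
      ≤ 1 / (30 * (1 - b ^ 2 / 4) ^ 3) / n ^ 4 := by
  let F : ℝ → ℝ := fun x => Real.arctan ((x - b / 2) / √(1 - b ^ 2 / 4)) / √(1 - b ^ 2 / 4)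
  refine ⟨F 1 - F 0, fun n hn => le_of_eq_of_le (congrArg abs ?_) ((corrected_trapezoid_sum
    (F := F) (hasDerivAt_primitive_fb hb) (hasDerivAt_fb hb) (hasDerivAt_deriv_fb hb)
    (hasDerivAt_deriv2_fb hb) (hasDerivAt_deriv3_fb hb) (abs_deriv4_fb_le hb) hn).trans_eq ?_)⟩
  rotate_left
  · field_simp
    norm_num
  · have hb2 : 2 - b ≠ 0 := by rintro h; rw [show b = 2 by linarith] at hb; norm_num at hb
    have h1 : fb b 1 = 1 / (2 - b) := by rw [fb]; ring
    have h0 : fb b 0 = 1 := by simp [fb]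
    have hd : (b - 2 * 0) / (1 - b * 0 + 0 ^ 2) ^ 2 - (b - 2 * 1) / (1 - b * 1 + 1 ^ 2) ^ 2 =
        b + 1 / (2 - b) := by
      rw [show (1 - b * 1 + 1 ^ 2 : ℝ) = 2 - b by ring]
      field_simp
      ring
    rw [h1, h0, hd]
    ring

lemma rightRiemannSum_fb_expansion {b : ℝ} (hb : 0 < 1 - b ^ 2 / 4) :
    ∃ I : ℝ, ∀ n : ℕ, 1 ≤ n → |rightRiemannSum (fb b) n
      - (I + -(1 - 1 / (2 - b)) / 2 / n + -(b + 1 / (2 - b)) / 12 / n ^ 2)|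
      ≤ 1 / (30 * (1 - b ^ 2 / 4) ^ 3) / n ^ 4 := by
  obtain ⟨I, hI⟩ := leftRiemannSum_fb_expansion hb
  refine ⟨I, fun n hn => le_of_eq_of_le (congrArg abs ?_) (hI n hn)⟩
  have h1 : fb b 1 = 1 / (2 - b) := by rw [fb]; ring
  have h0 : fb b 0 = 1 := by simp [fb]
  rw [rightRiemannSum_eq _ hn, h1, h0]
  ring

lemma neg_expansion {A : ℕ → ℝ} {I p q K : ℝ}
    (h : ∀ n : ℕ, 1 ≤ n → |A n - (I + -p / 2 / n + -q / 12 / n ^ 2)| ≤ K / n ^ 4) (n : ℕ)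
    (hn : 1 ≤ n) : |-A n - (-I + p / 2 / n + q / 12 / n ^ 2)| ≤ K / n ^ 4 := by
  rw [← abs_neg]
  exact le_of_eq_of_le (congrArg abs (by ring)) (h n hn)

lemma leftRiemannSum_fb_one (b : ℝ) : leftRiemannSum (fb b) 1 = 1 := by
  simp [leftRiemannSum, fb]

lemma leftRiemannSum_fb_two (b : ℝ) : leftRiemannSum (fb b) 2 = (1 + 4 / (5 - 2 * b)) / 2 := by
  have : (1 - b * (1 / 2) + (1 / 2) ^ 2 : ℝ) = (5 - 2 * b) / 4 := by ring
  simp only [leftRiemannSum, fb, Finset.sum_range_succ, Finset.sum_range_zero]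
  push_cast
  rw [this, one_div_div]
  ring

lemma rightRiemannSum_fb_one (b : ℝ) : rightRiemannSum (fb b) 1 = 1 / (2 - b) := by
  have : (1 - b * 1 + 1 ^ 2 : ℝ) = 2 - b := by ring
  simp [rightRiemannSum, fb]
  linarith

lemma rightRiemannSum_fb_two (b : ℝ) :
    rightRiemannSum (fb b) 2 = (4 / (5 - 2 * b) + 1 / (2 - b)) / 2 := by
  rw [rightRiemannSum_eq _ one_le_two, leftRiemannSum_fb_two]
  have h1 : fb b 1 = 1 / (2 - b) := by rw [fb]; ring
  have h0 : fb b 0 = 1 := by simp [fb]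
  rw [h1, h0]
  push_cast
  ring

/-! ### Monotonicity for `b ≤ 1/2` (left) and `b ≤ 1` (right) -/

lemma convexOn_fb {b : ℝ} (hb : b ≤ -1) : ConvexOn ℝ (Set.Icc 0 1) (fb b) := by
  refine ⟨convex_Icc 0 1, fun x hx y hy s t hs ht hst => ?_⟩
  have hz := convex_Icc (0 : ℝ) 1 hx hy hs ht hst
  have hpos : ∀ w ∈ Set.Icc (0 : ℝ) 1, 0 < 1 - b * w + w ^ 2 := fun w hw => by nlinarith [hw.1]
  have hA := hpos x hx
  have hB := hpos y hy
  have hC := hpos _ hz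
  simp only [smul_eq_mul, fb] at *
  have hbx : 0 ≤ -b * x := mul_nonneg (by linarith) hx.1
  have hby : 0 ≤ -b * y := mul_nonneg (by linarith) hy.1
  have hxy : 0 ≤ x * y := mul_nonneg hx.1 hy.1
  have h1 : 1 - b * x + x ^ 2 ≤ (x + y - b) ^ 2 := by nlinarith [sq_nonneg y]
  have h2 : 1 - b * y + y ^ 2 ≤ (x + y - b) ^ 2 := by nlinarith [sq_nonneg x]
  have h3 : s * (1 - b * y + y ^ 2) + t * (1 - b * x + x ^ 2) ≤ (x + y - b) ^ 2 := by
    calc _ ≤ s * (x + y - b) ^ 2 + t * (x + y - b) ^ 2 := by gcongr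
      _ = _ := by rw [← add_mul, hst, one_mul]
  have h4 := mul_le_mul_of_nonneg_left h3 (mul_nonneg (mul_nonneg hs ht) (sq_nonneg (x - y)))
  -- With `A`, `B`, `C` the denominators at `x`, `y`, `sx + ty`: `(sB + tA)C - AB =
  -- st(x-y)²((x+y-b)² - (sB + tA))`.
  rw [mul_one_div, mul_one_div, div_add_div _ _ hA.ne' hB.ne', div_le_div_iff₀ hC (mul_pos hA hB)]
  obtain rfl : t = 1 - s := by linarith
  linarith

lemma fb_one_le {b : ℝ} (hb : b ≤ 0) : ∀ x ∈ Set.Icc (0 : ℝ) 1, fb b 1 ≤ fb b x := by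
  intro x hx
  refine one_div_le_one_div_of_le ?_ ?_ <;> nlinarith [hx.1, hx.2]

lemma leftRiemannSum_fb_antitoneOn {b : ℝ} (hb : b ≤ 1 / 2) :
    AntitoneOn (fun n : ℕ => leftRiemannSum (fb b) n) (Set.Ici 1) := by
  refine antitoneOn_nat_Ici_of_succ_le fun n hn => ?_
  rcases le_or_gt b (-1) with hb1 | hb1
  · exact leftRiemannSum_succ_le_of_convexOn (convexOn_fb hb1) (fb_one_le (by linarith)) hn
  rcases eq_or_lt_of_le hn with rfl | hn
  · rw [leftRiemannSum_fb_one, leftRiemannSum_fb_two]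
    have : 4 / (5 - 2 * b) ≤ 1 := by rw [div_le_one (by linarith)]; linarith
    linarith
  have hS : 3 / 4 ≤ 1 - b ^ 2 / 4 := by nlinarith
  have hK : 1 / (30 * (1 - b ^ 2 / 4) ^ 3) ≤ 1 / (30 * (3 / 4) ^ 3) := by gcongr
  obtain ⟨I, hI⟩ := leftRiemannSum_fb_expansion (b := b) (by linarith)
  have hu : 1 / (2 - b) ≤ 2 / 3 := by
    rw [div_le_div_iff₀ (by linarith) (by norm_num)]; linarith
  refine step_of_expansion ?_ ?_ ?_ hI hn <;> linarith

lemma rightRiemannSum_fb_monotoneOn {b : ℝ} (hb : b ≤ 1) :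
    MonotoneOn (fun n : ℕ => rightRiemannSum (fb b) n) (Set.Ici 1) := by
  refine monotoneOn_nat_Ici_of_le_succ fun n hn => ?_
  rcases le_or_gt b (-1) with hb1 | hb1
  · exact rightRiemannSum_le_succ_of_convexOn (convexOn_fb hb1) (fb_one_le (by linarith)) hn
  rcases eq_or_lt_of_le hn with rfl | hn
  · rw [rightRiemannSum_fb_one, rightRiemannSum_fb_two]
    have : 1 / (2 - b) ≤ 4 / (5 - 2 * b) := by
      rw [div_le_div_iff₀ (by linarith) (by linarith)]; linarith
    linarith
  have hS : 3 / 4 ≤ 1 - b ^ 2 / 4 := by nlinarith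
  have hK : 1 / (30 * (1 - b ^ 2 / 4) ^ 3) ≤ 1 / (30 * (3 / 4) ^ 3) := by gcongr
  obtain ⟨I, hI⟩ := rightRiemannSum_fb_expansion (b := b) (by linarith)
  have hu : 1 / (2 - b) ≤ 1 := by rw [div_le_one (by linarith)]; linarith
  -- Chord of the convex function `1/(2-b)` over `[-1, 1]`; bounding `b` and `1/(2-b)` separately
  -- would be too weak.
  have hu' : 1 / (2 - b) ≤ 2 / 3 + b / 3 := by
    rw [div_le_iff₀ (by linarith)]; nlinarith
  exact neg_le_neg_iff.1
    (step_of_expansion (by linarith) (by linarith) (by linarith) (neg_expansion hI) hn)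

/-! ### Monotonicity up to `betaPlus`, used only through `2 - b ≥ 0.348` -/

lemma betaPlus_bounds : betaPlus ≤ 1.652 := by
  have : √13 ≤ 3.608 := by rw [Real.sqrt_le_left (by norm_num)]; norm_num
  rw [betaPlus]; linarith

/-- A linear lower bound for `(2 - b) ^ 2 * (2 + b) ^ 3`, written in terms of `u = 2 - b`. -/
lemma linear_le_sq_mul_cube {u : ℝ} (h0 : 0.348 ≤ u) (h1 : u ≤ 1) :
    5.8 + 29 * (u - 0.348) ≤ u ^ 2 * (4 - u) ^ 3 := by
  have h2 : 64 - 48 * u + 11 * u ^ 2 ≤ (4 - u) ^ 3 := by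
    nlinarith [mul_nonneg (sq_nonneg u) (sub_nonneg.2 h1)]
  have h3 := mul_le_mul_of_nonneg_left h2 (sq_nonneg u)
  -- Factors found by dividing by `u - 0.348` twice, up to small remainders.
  have h4 : 0 ≤ (u - 0.348) * (11 * u ^ 3 - 44.172 * u ^ 2 + 48.6 * u - 12) := by
    refine mul_nonneg (by linarith) ?_
    have : 0 ≤ (u - 0.348) * (11 * u ^ 2 - 40.344 * u + 34.56) :=
      mul_nonneg (by linarith) (by nlinarith)
    nlinarith
  nlinarith

/-- With `u = 2 - b`, `1 - b²/4 = u(4-u)/4`, so the left side is `c / (u(4-u))³` with `c =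
97·64/1080 < 5.749`. -/
lemma remainder_constant_le {u N : ℝ} (h0 : 0.348 ≤ u) (h1 : u ≤ 1)
    (hN : 5.749 ≤ N * (5.8 + 29 * (u - 0.348))) :
    97 / 36 * (1 / (30 * (1 - (2 - u) ^ 2 / 4) ^ 3)) ≤ N / u := by
  have hu : 0 < u := by linarith
  have h4 : 0 < 4 - u := by linarith
  have hN0 : 0 ≤ N := by
    by_contra h
    nlinarith [mul_nonneg (by linarith : 0 ≤ -N) (by linarith : 0 ≤ 5.8 + 29 * (u - 0.348))]
  have hl := mul_le_mul_of_nonneg_left (linear_le_sq_mul_cube h0 h1) hN0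
  rw [show 1 - (2 - u) ^ 2 / 4 = u * (4 - u) / 4 by ring, mul_one_div,
    div_le_div_iff₀ (by positivity) hu]
  have := mul_le_mul_of_nonneg_right (hN.trans hl) hu.le
  nlinarith

lemma leftRiemannSum_fb_monotoneOn {b : ℝ} (hb : b ∈ Set.Icc 1 betaPlus) :
    MonotoneOn (fun n : ℕ => leftRiemannSum (fb b) n) (Set.Ici 1) := by
  have hb2 := hb.2.trans betaPlus_bounds
  have hb1 := hb.1
  refine monotoneOn_nat_Ici_of_le_succ fun n hn => ?_
  rcases eq_or_lt_of_le hn with rfl | hn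
  · rw [leftRiemannSum_fb_one, leftRiemannSum_fb_two]
    have : 1 ≤ 4 / (5 - 2 * b) := by rw [one_le_div (by linarith)]; linarith
    linarith
  obtain ⟨I, hI⟩ := leftRiemannSum_fb_expansion (b := b) (by nlinarith)
  obtain ⟨u, rfl⟩ : ∃ u, b = 2 - u := ⟨2 - b, by ring⟩
  rw [sub_sub_cancel] at hI
  have hu : 0 < u := by linarith
  have hu1 : 1 ≤ 1 / u := by rw [one_le_div hu]; linarith
  have hp : (1 - 1 / u) / 2 = -(1 / u - 1) / 2 := by ring
  rw [hp] at hI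
  -- `N` is `u(6p + 5q)` for the expansion of `-L_n`.
  have hK := remainder_constant_le (u := u) (N := 41 / 12 - 13 / 6 * u - 5 / 12 * u ^ 2)
    (by linarith) (by linarith) (by nlinarith)
  have e : (41 / 12 - 13 / 6 * u - 5 / 12 * u ^ 2) / u = 41 / 12 * (1 / u) - 13 / 6 - 5 / 12 * u := by
    field_simp
  exact neg_le_neg_iff.1
    (step_of_expansion (by linarith) (by linarith) (by linarith) (neg_expansion hI) hn)

lemma rightRiemannSum_fb_antitoneOn {b : ℝ} (hb : b ∈ Set.Icc (3 / 2) betaPlus) :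
    AntitoneOn (fun n : ℕ => rightRiemannSum (fb b) n) (Set.Ici 1) := by
  have hb2 := hb.2.trans betaPlus_bounds
  have hb1 := hb.1
  refine antitoneOn_nat_Ici_of_succ_le fun n hn => ?_
  rcases eq_or_lt_of_le hn with rfl | hn
  · rw [rightRiemannSum_fb_one, rightRiemannSum_fb_two]
    have : 4 / (5 - 2 * b) ≤ 1 / (2 - b) := by
      rw [div_le_div_iff₀ (by linarith) (by linarith)]; linarith
    linarith
  obtain ⟨I, hI⟩ := rightRiemannSum_fb_expansion (b := b) (by nlinarith)
  obtain ⟨u, rfl⟩ : ∃ u, b = 2 - u := ⟨2 - b, by ring⟩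
  rw [sub_sub_cancel] at hI
  have hu : 0 < u := by linarith
  have hu1 : 2 ≤ 1 / u := by rw [le_div_iff₀ hu]; linarith
  -- `N` is `u(6p + 5q)` for the expansion of `R_n`.
  have hK := remainder_constant_le (u := u) (N := 31 / 12 - 23 / 6 * u + 5 / 12 * u ^ 2)
    (by linarith) (by linarith) (by nlinarith)
  have e : (31 / 12 - 23 / 6 * u + 5 / 12 * u ^ 2) / u = 31 / 12 * (1 / u) - 23 / 6 + 5 / 12 * u := by
    field_simp
  exact step_of_expansion (by linarith) (by linarith) (by linarith) hI hn

theorem theorem3p1 :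
    ((∀ b : ℝ, b ≤ 1 / 2 → AntitoneOn (fun n : ℕ => leftRiemannSum (fb b) n) (Set.Ici 1)) ∧
      (∀ b : ℝ, b ∈ Set.Icc 1 betaPlus →
        MonotoneOn (fun n : ℕ => leftRiemannSum (fb b) n) (Set.Ici 1))) ∧
    ((∀ b : ℝ, b ≤ 1 → MonotoneOn (fun n : ℕ => rightRiemannSum (fb b) n) (Set.Ici 1)) ∧
      (∀ b : ℝ, b ∈ Set.Icc (3 / 2) betaPlus →
        AntitoneOn (fun n : ℕ => rightRiemannSum (fb b) n) (Set.Ici 1))) :=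
  ⟨⟨fun _ => leftRiemannSum_fb_antitoneOn, fun _ => leftRiemannSum_fb_monotoneOn⟩,
    fun _ => rightRiemannSum_fb_monotoneOn, fun _ => rightRiemannSum_fb_antitoneOn⟩
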